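/- Let $n\ge 1$ be an integer and let $\alpha>n/2$. For $u\in L^2(\mathbb{R}^n)$ (complex valued) let $\widehat u$ be its $L^2$ Fourier transform, normalized so that $\widehat u(\xi)=\int_{\mathbb{R}^n}e^{-i\xi\cdot x}u(x)\,dx$ for $u\in L^1\cap L^2$, and let $$H^\alpha(\mathbb{R}^n)=\Big\{u\in L^2(\mathbb{R}^n):\int_{\mathbb{R}^n}(1+|\xi|^2)^\alpha|\widehat u(\xi)|^2\,d\xi<\infty\Big\},\qquad (u,v)_{H^\alpha(\mathbb{R}^n)}=(2\pi)^{-n}\int_{\mathbb{R}^n}\widehat u(\xi)\,\overline{\widehat v(\xi)}\,(1+|\xi|^2)^\alpha\,d\xi .$$ Let $$G_\alpha(x)=\frac{1}{2^{\alpha-1+\frac n2}\,\pi^{\frac n2}\,\Gamma(\alpha)}\,K_{\alpha-\frac n2}(|x|)\,|x|^{\alpha-\frac n2}\qquad(x\in\mathbb{R}^n),$$ where $K_\nu$ is the modified Bessel function of the second kind (the value at $x=0$ being the limit). A sequence $\{f_j\}_{j\in\mathbb{N}}$ in a Hilbert space $H$ is called a Riesz sequence if its moment space equals $\ell^2(\mathbb{N})$,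 that is, $\big\{\big((f,f_j)_H\big)_{j\in\mathbb{N}}: f\in H\big\}=\ell^2(\mathbb{N})$. Let $X=\{x_j\}_{j\in\mathbb{N}}\subset\mathbb{R}^n$ be an arbitrary sequence of points with $$\delta(X)=\inf_{j\neq k}|x_j-x_k|>0 .$$ Then $G_\alpha(\cdot-x_j)\in H^\alpha(\mathbb{R}^n)$ for every $j$, and: (i) if $n\ge 2$, then $\{G_\alpha(x-x_j)\}_{j\in\mathbb{N}}$ is a Riesz sequence in $H^\alpha(\mathbb{R}^n)$; (ii) if $n=1$ and $$\delta(X)>\frac{4\,\Gamma(\alpha)\,\Gamma(1/2)}{\Gamma(\alpha-1/2)},$$ then $\{G_\alpha(x-x_j)\}_{j\in\mathbb{N}}$ is a Riesz sequence in $H^\alpha(\mathbb{R})$. -/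

import Mathlib

open MeasureTheory
open scoped FourierTransform

noncomputable section

namespace BesselRiesz

/-! ### Bessel potential kernels -/

/-- The modified Bessel function of the second kind `K_ν(z)`, for real order `ν` and `z > 0`,
given by `K_ν(z) = (1/2) ∫_{-∞}^{∞} exp (-z cosh t - ν t) dt`. -/
def besselK (ν z : ℝ) : ℝ :=
  (1 / 2) * ∫ t : ℝ, Real.exp (-z * Real.cosh t - ν * t)

/-- The profile of the Bessel potential kernel of order `α` in dimension `n`:
`G_α(z) = K_{α - n/2}(z) z^{α - n/2} / (2^{α - 1 + n/2} π^{n/2} Γ(α))` for `z > 0`.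
At `z = 0` it is given its limit, which for `α > n/2` is `Γ(α - n/2) / ((4π)^{n/2} Γ(α))`. -/
def besselProfile (n : ℕ) (α z : ℝ) : ℝ :=
  if z = 0 then
    Real.Gamma (α - n / 2) / ((4 * Real.pi) ^ ((n : ℝ) / 2) * Real.Gamma α)
  else
    1 / (2 ^ (α - 1 + (n : ℝ) / 2) * Real.pi ^ ((n : ℝ) / 2) * Real.Gamma α)
      * besselK (α - n / 2) z * z ^ (α - (n : ℝ) / 2)

/-- The radial extension `G_α(x) = G_α(|x|)` to `ℝⁿ`. -/
def besselG (n : ℕ) (α : ℝ) (x : EuclideanSpace ℝ (Fin n)) : ℝ :=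
  besselProfile n α ‖x‖

/-! ### The Sobolev space `H^α(ℝⁿ)` -/

/-- `L²(ℝⁿ)`, complex valued. -/
abbrev L2 (n : ℕ) : Type := Lp (α := EuclideanSpace ℝ (Fin n)) ℂ 2 volume

/-- The `L²` Fourier transform in the normalization `û(ξ) = ∫ e^{-i ξ·x} u(x) dx`. Mathlib's
transform `𝓕` uses the phase `e^{-2π i ξ·x}`, hence the dilation by `1/(2π)`. -/
def fourierHat {n : ℕ} (u : L2 n) (ξ : EuclideanSpace ℝ (Fin n)) : ℂ :=
  (𝓕 u : L2 n) ((2 * Real.pi)⁻¹ • ξ)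

/-- The weight `(1 + |ξ|²)^α`. -/
def weight {n : ℕ} (α : ℝ) (ξ : EuclideanSpace ℝ (Fin n)) : ℝ := (1 + ‖ξ‖ ^ 2) ^ α

lemma weight_pos {n : ℕ} (α : ℝ) (ξ : EuclideanSpace ℝ (Fin n)) : 0 < weight α ξ :=
  Real.rpow_pos_of_pos (by positivity) _

lemma continuous_weight {n : ℕ} (α : ℝ) :
    Continuous (weight α : EuclideanSpace ℝ (Fin n) → ℝ) := by
  unfold weight
  refine Continuous.rpow_const (by fun_prop) fun ξ => Or.inl ?_
  positivity

lemma two_pi_inv_ne : (2 * Real.pi)⁻¹ ≠ 0 := by positivity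

lemma quasi_dilation (n : ℕ) : Measure.QuasiMeasurePreserving
    (fun ξ : EuclideanSpace ℝ (Fin n) => (2 * Real.pi)⁻¹ • ξ) volume volume :=
  Measure.quasiMeasurePreserving_smul volume two_pi_inv_ne

lemma aestronglyMeasurable_fourierHat {n : ℕ} (u : L2 n) :
    AEStronglyMeasurable (fourierHat u) volume :=
  (Lp.aestronglyMeasurable (𝓕 u : L2 n)).comp_quasiMeasurePreserving (quasi_dilation n)

lemma fourierHat_add {n : ℕ} (u v : L2 n) :
    fourierHat (u + v) =ᵐ[volume] fun ξ => fourierHat u ξ + fourierHat v ξ := by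
  have h : (𝓕 (u + v) : L2 n) = 𝓕 u + 𝓕 v := FourierTransform.fourier_add u v
  have h2 := (quasi_dilation n).ae (Lp.coeFn_add (𝓕 u : L2 n) (𝓕 v))
  filter_upwards [h2] with ξ hξ
  simpa [fourierHat, h] using hξ

lemma fourierHat_smul {n : ℕ} (c : ℂ) (u : L2 n) :
    fourierHat (c • u) =ᵐ[volume] fun ξ => c * fourierHat u ξ := by
  have h : (𝓕 (c • u) : L2 n) = c • 𝓕 u := FourierTransform.fourier_smul c u
  have h2 := (quasi_dilation n).ae (Lp.coeFn_smul c (𝓕 u : L2 n))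
  filter_upwards [h2] with ξ hξ
  simpa [fourierHat, h] using hξ

lemma fourierHat_zero {n : ℕ} : fourierHat (0 : L2 n) =ᵐ[volume] fun _ => 0 := by
  simpa using fourierHat_smul (0 : ℂ) (0 : L2 n)

lemma eq_zero_of_fourierHat {n : ℕ} (u : L2 n) (h : fourierHat u =ᵐ[volume] fun _ => 0) :
    u = 0 := by
  have h1 : Measure.QuasiMeasurePreserving
      (fun ξ : EuclideanSpace ℝ (Fin n) => (2 * Real.pi) • ξ) volume volume :=
    Measure.quasiMeasurePreserving_smul volume (by positivity)
  have h2 : (𝓕 u : L2 n) = 0 := by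
    rw [Lp.eq_zero_iff_ae_eq_zero]
    filter_upwards [h1.ae h] with ξ hξ
    have hp : (2 * Real.pi) ≠ 0 := by positivity
    simpa only [fourierHat, smul_smul, inv_mul_cancel₀ hp, one_smul, Pi.zero_apply] using hξ
  have h3 : ‖u‖ = 0 := by rw [← Lp.norm_fourier_eq u, h2, norm_zero]
  exact norm_eq_zero.1 h3

/-- `u` has finite `H^α` energy: `∫ (1 + |ξ|²)^α |û(ξ)|² dξ < ∞`. -/
def FiniteEnergy {n : ℕ} (α : ℝ) (u : L2 n) : Prop :=
  Integrable (fun ξ => weight α ξ * ‖fourierHat u ξ‖ ^ 2) volume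

lemma FiniteEnergy.add {n : ℕ} {α : ℝ} {u v : L2 n} (hu : FiniteEnergy α u)
    (hv : FiniteEnergy α v) : FiniteEnergy α (u + v) := by
  refine ((hu.const_mul 2).add (hv.const_mul 2)).mono' ?_ ?_
  · exact (continuous_weight α).aestronglyMeasurable.mul
      ((aestronglyMeasurable_fourierHat _).norm.pow 2)
  · filter_upwards [fourierHat_add u v] with ξ hξ
    have hw := weight_pos α ξ
    rw [Real.norm_of_nonneg (by positivity), hξ]
    have h1 := norm_add_le (fourierHat u ξ) (fourierHat v ξ)
    have h2 : ‖fourierHat u ξ + fourierHat v ξ‖ ^ 2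
        ≤ 2 * ‖fourierHat u ξ‖ ^ 2 + 2 * ‖fourierHat v ξ‖ ^ 2 := by
      nlinarith [norm_nonneg (fourierHat u ξ + fourierHat v ξ),
        sq_nonneg (‖fourierHat u ξ‖ - ‖fourierHat v ξ‖)]
    have h3 := mul_le_mul_of_nonneg_left h2 hw.le
    simp only [Pi.add_apply]
    linarith

lemma FiniteEnergy.smul {n : ℕ} {α : ℝ} {u : L2 n} (c : ℂ) (hu : FiniteEnergy α u) :
    FiniteEnergy α (c • u) := by
  refine (hu.const_mul (‖c‖ ^ 2)).congr ?_
  filter_upwards [fourierHat_smul c u] with ξ hξ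
  rw [hξ, norm_mul]
  ring

lemma FiniteEnergy.zero {n : ℕ} {α : ℝ} : FiniteEnergy α (0 : L2 n) := by
  refine (integrable_zero _ _ _).congr ?_
  filter_upwards [fourierHat_zero (n := n)] with ξ hξ
  simp [hξ]

/-- `H^α(ℝⁿ) = {u ∈ L²(ℝⁿ) : ∫ (1 + |ξ|²)^α |û(ξ)|² dξ < ∞}` as a subspace of `L²(ℝⁿ)`. -/
def sobolevSubmodule (n : ℕ) (α : ℝ) : Submodule ℂ (L2 n) where
  carrier := {u | FiniteEnergy α u}
  add_mem' := FiniteEnergy.add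
  zero_mem' := FiniteEnergy.zero
  smul_mem' c _ hu := hu.smul c

/-- The vector space `H^α(ℝⁿ)`; it is a separate type because it carries its own inner product
and not the one of `L²(ℝⁿ)`. -/
def SobolevSpace (n : ℕ) (α : ℝ) : Type := sobolevSubmodule n α

namespace SobolevSpace

variable {n : ℕ} {α : ℝ}

/-- The underlying `L²` class of an element of `H^α(ℝⁿ)`. -/
def toL2 (u : SobolevSpace n α) : L2 n := Subtype.val u

lemma finiteEnergy (u : SobolevSpace n α) : FiniteEnergy α u.toL2 := Subtype.property u

instance instAddCommGroup : AddCommGroup (SobolevSpace n α) :=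
  inferInstanceAs (AddCommGroup (sobolevSubmodule n α))

instance instModule : Module ℂ (SobolevSpace n α) :=
  inferInstanceAs (Module ℂ (sobolevSubmodule n α))

lemma toL2_add (u v : SobolevSpace n α) : (u + v).toL2 = u.toL2 + v.toL2 := rfl

lemma toL2_smul (c : ℂ) (u : SobolevSpace n α) : (c • u).toL2 = c • u.toL2 := rfl

lemma toL2_injective : Function.Injective (toL2 : SobolevSpace n α → L2 n) :=
  Subtype.val_injective

/-- The `H^α` inner product `(2π)^{-n} ∫ û(ξ) v̂(ξ)^* (1 + |ξ|²)^α dξ`. Following Mathlib it is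
conjugate linear in the first argument, so `sobolevInner v u` is the product `(u, v)` that is
linear in `u`. -/
def sobolevInner (v u : SobolevSpace n α) : ℂ :=
  (((2 * Real.pi) ^ n)⁻¹ : ℝ) *
    ∫ ξ, fourierHat u.toL2 ξ * (starRingEnd ℂ) (fourierHat v.toL2 ξ) * (weight α ξ : ℂ)

lemma integrable_inner (v u : SobolevSpace n α) :
    Integrable (fun ξ => fourierHat u.toL2 ξ * (starRingEnd ℂ) (fourierHat v.toL2 ξ)
      * (weight α ξ : ℂ)) volume := by
  have hs : Integrable (fun ξ => weight α ξ * ‖fourierHat u.toL2 ξ‖ ^ 2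
      + weight α ξ * ‖fourierHat v.toL2 ξ‖ ^ 2) volume :=
    Integrable.add u.finiteEnergy v.finiteEnergy
  refine hs.mono' ?_ ?_
  · refine ((aestronglyMeasurable_fourierHat _).mul
      (Complex.continuous_conj.comp_aestronglyMeasurable
        (aestronglyMeasurable_fourierHat _))).mul ?_
    exact (Complex.continuous_ofReal.comp (continuous_weight α)).aestronglyMeasurable
  · refine Filter.Eventually.of_forall fun ξ => ?_
    have hw := weight_pos α ξ
    simp only [norm_mul, RCLike.norm_conj, Complex.norm_real, Real.norm_of_nonneg hw.le]
    nlinarith [mul_nonneg hw.le (sq_nonneg (‖fourierHat u.toL2 ξ‖ - ‖fourierHat v.toL2 ξ‖)),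
      mul_nonneg hw.le (sq_nonneg (‖fourierHat u.toL2 ξ‖)),
      mul_nonneg hw.le (sq_nonneg (‖fourierHat v.toL2 ξ‖))]

lemma sobolevInner_self (u : SobolevSpace n α) :
    sobolevInner u u =
      ((((2 * Real.pi) ^ n)⁻¹ * ∫ ξ, weight α ξ * ‖fourierHat u.toL2 ξ‖ ^ 2 : ℝ) : ℂ) := by
  unfold sobolevInner
  rw [Complex.ofReal_mul, ← integral_complex_ofReal]
  congr 2
  ext ξ
  rw [Complex.mul_conj, Complex.normSq_eq_norm_sq]
  push_cast
  ring

/-- The inner product structure of `H^α(ℝⁿ)`. -/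
@[reducible] def core (n : ℕ) (α : ℝ) : InnerProductSpace.Core ℂ (SobolevSpace n α) where
  inner := sobolevInner
  conj_inner_symm x y := by
    simp only [sobolevInner, map_mul, Complex.conj_ofReal]
    rw [← integral_conj]
    refine congrArg ((((2 * Real.pi) ^ n)⁻¹ : ℝ) * · : ℂ → ℂ) (integral_congr_ae (Filter.Eventually.of_forall fun ξ => ?_))
    simp only [map_mul, Complex.conj_conj, Complex.conj_ofReal]
    ring
  re_inner_nonneg x := by
    rw [sobolevInner_self]
    simp only [RCLike.re_to_complex, Complex.ofReal_re]
    refine mul_nonneg (by positivity) (integral_nonneg fun ξ => ?_)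
    exact mul_nonneg (weight_pos α ξ).le (sq_nonneg _)
  add_left x y z := by
    simp only [sobolevInner]
    rw [← mul_add, ← integral_add (integrable_inner x z) (integrable_inner y z)]
    refine congrArg ((((2 * Real.pi) ^ n)⁻¹ : ℝ) * · : ℂ → ℂ) (integral_congr_ae ?_)
    filter_upwards [fourierHat_add x.toL2 y.toL2] with ξ hξ
    rw [toL2_add, hξ, map_add]
    ring
  smul_left x y r := by
    simp only [sobolevInner]
    rw [mul_left_comm, ← integral_const_mul ((starRingEnd ℂ) r)]
    refine congrArg ((((2 * Real.pi) ^ n)⁻¹ : ℝ) * · : ℂ → ℂ) (integral_congr_ae ?_)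
    filter_upwards [fourierHat_smul r x.toL2] with ξ hξ
    rw [toL2_smul, hξ, map_mul]
    ring
  definite x hx := by
    have hx' : sobolevInner x x = 0 := hx
    rw [sobolevInner_self, Complex.ofReal_eq_zero, mul_eq_zero] at hx'
    have h0 : ∫ ξ, weight α ξ * ‖fourierHat x.toL2 ξ‖ ^ 2 = 0 :=
      hx'.resolve_left (by positivity)
    rw [integral_eq_zero_iff_of_nonneg
      (fun ξ => mul_nonneg (weight_pos α ξ).le (sq_nonneg _)) x.finiteEnergy] at h0
    refine toL2_injective (eq_zero_of_fourierHat _ ?_)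
    filter_upwards [h0] with ξ hξ
    have := (mul_eq_zero.1 hξ).resolve_left (weight_pos α ξ).ne'
    simpa using this

instance instNormedAddCommGroup : NormedAddCommGroup (SobolevSpace n α) :=
  (core n α).toNormedAddCommGroup

instance instInnerProductSpace : InnerProductSpace ℂ (SobolevSpace n α) :=
  InnerProductSpace.ofCore (core n α).toCore

lemma inner_eq (v u : SobolevSpace n α) : inner ℂ v u = sobolevInner v u := rfl

end SobolevSpace

/-! ### Riesz sequences and separation -/

/-- A system `(f_j)` in `H` is a Riesz sequence if its moment space
`{((f, f_j)_H)_j : f ∈ H}` is equal to `ℓ²(ℕ)`. -/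
def IsRieszSequence {H : Type*} [NormedAddCommGroup H] [InnerProductSpace ℂ H]
    (f : ℕ → H) : Prop :=
  Set.range (fun (h : H) (j : ℕ) => inner ℂ (f j) h) = {c : ℕ → ℂ | Memℓp c 2}

/-- The separation radius `δ(X) = inf_{j ≠ k} |x_j - x_k|`. -/
def separation {n : ℕ} (x : ℕ → EuclideanSpace ℝ (Fin n)) : ℝ :=
  ⨅ p : {p : ℕ × ℕ // p.1 ≠ p.2}, ‖x p.1.1 - x p.1.2‖

end BesselRiesz

end

/-! The moment space of a system in a Hilbert space is `ℓ²` as soon as its finite sums satisfy `A ∑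
|c_j|² ≤ ‖∑ c_j f_j‖² ≤ B ∑ |c_j|²` with `A > 0` (`isRieszSequence_of_gram_bounds`). The translates
of `G_α` satisfy both bounds for every separated sequence, by an argument that is the same in all
dimensions.

On the Fourier side `G_α(· - x_j)` is a character times `(1 + |ξ|²)^{-α}`. Hence the Gram matrix is
`G_α(x_j - x_k)`, and `‖∑ c_j f_j‖²` is the integral of `|P|²` against `(1 + |ξ|²)^{-α}`, where `P`
is the trigonometric sum with frequencies `x_j`.

Upper bound: `G_α` is a positive average of heat kernels. Packing disjoint balls around the points
bounds the off-diagonal Gaussian sums uniformly in time, so the Gram rows are uniformly summable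
(`exists_sum_besselG_le`), and Schur's test applies.

Lower bound: take a bump `Φ` supported in the ball of radius `δ/2`. Its transform decays rapidly, so
`|𝓕 Φ|² ≤ C (1 + |ξ|²)^{-α}`, up to the dilation by `2π`. The translates `Φ(· - x_j)` have disjoint
supports, so Plancherel evaluates the integral of `|P|² |𝓕 Φ|²` as `‖Φ‖² ∑ |c_j|²`
(`integral_trigSum_mul_fourier`). -/

namespace BesselRiesz

/-! ### Gram bounds and Riesz sequences -/

section RieszSequence

variable {H : Type*} [NormedAddCommGroup H] [InnerProductSpace ℂ H]

/-- An upper Gram bound on finite sums implies Bessel's inequality. -/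
lemma sum_norm_inner_sq_le {f : ℕ → H} {B : ℝ}
    (hB : ∀ (s : Finset ℕ) (c : ℕ → ℂ), ‖∑ j ∈ s, c j • f j‖ ^ 2 ≤ B * ∑ j ∈ s, ‖c j‖ ^ 2)
    (h : H) (s : Finset ℕ) : ∑ j ∈ s, ‖inner ℂ (f j) h‖ ^ 2 ≤ B * ‖h‖ ^ 2 := by
  set c : ℕ → ℂ := fun j => inner ℂ (f j) h with hc
  set v := ∑ j ∈ s, c j • f j with hv
  set Q := ∑ j ∈ s, ‖c j‖ ^ 2 with hQ
  have hQ0 : 0 ≤ Q := Finset.sum_nonneg fun j _ => sq_nonneg _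
  have h1 : inner ℂ v h = (Q : ℂ) := by
    rw [hv, sum_inner, hQ, Complex.ofReal_sum]
    refine Finset.sum_congr rfl fun j _ => ?_
    rw [inner_smul_left, ← Complex.normSq_eq_norm_sq, Complex.normSq_eq_conj_mul_self]
  have h2 : Q ≤ ‖v‖ * ‖h‖ := by
    have := norm_inner_le_norm (𝕜 := ℂ) v h
    rwa [h1, Complex.norm_real, Real.norm_of_nonneg hQ0] at this
  have h3 : ‖v‖ ^ 2 ≤ B * Q := hB s c
  have h4 : Q * Q ≤ Q * (B * ‖h‖ ^ 2) := by
    calc Q * Q ≤ (‖v‖ * ‖h‖) * (‖v‖ * ‖h‖) := mul_self_le_mul_self hQ0 h2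
      _ = ‖v‖ ^ 2 * ‖h‖ ^ 2 := by ring
      _ ≤ B * Q * ‖h‖ ^ 2 := by gcongr
      _ = _ := by ring
  -- Cancel one factor `Q`. If `Q = 0` the claim reduces to `B ≥ 0`, which the single vector `f 0`
  -- provides.
  rcases hQ0.eq_or_lt with h0 | h0
  · have hB0 : 0 ≤ B * ‖h‖ ^ 2 := by
      have hB1 := hB {0} fun _ => 1
      simp only [Finset.sum_singleton, norm_one, one_pow, mul_one] at hB1
      exact mul_nonneg ((sq_nonneg _).trans hB1) (sq_nonneg _)
    exact h0.symm.le.trans hB0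
  · exact le_of_mul_le_mul_left h4 h0

/-- A system with two sided Gram bounds on finite sums is a Riesz sequence. -/
theorem isRieszSequence_of_gram_bounds [CompleteSpace H] {f : ℕ → H} {A B : ℝ} (hA : 0 < A)
    (hlow : ∀ (s : Finset ℕ) (c : ℕ → ℂ), A * ∑ j ∈ s, ‖c j‖ ^ 2 ≤ ‖∑ j ∈ s, c j • f j‖ ^ 2)
    (hB : ∀ (s : Finset ℕ) (c : ℕ → ℂ), ‖∑ j ∈ s, c j • f j‖ ^ 2 ≤ B * ∑ j ∈ s, ‖c j‖ ^ 2) :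
    IsRieszSequence f := by
  have hbes := sum_norm_inner_sq_le hB
  have hB0 : 0 ≤ B := by
    have hB1 := hB {0} fun _ => 1
    simp only [Finset.sum_singleton, norm_one, one_pow, mul_one] at hB1
    exact (sq_nonneg _).trans hB1
  have hmem : ∀ h : H, Memℓp (fun j => inner ℂ (f j) h) 2 := fun h =>
    memℓp_gen' (C := B * ‖h‖ ^ 2) fun s => by simpa using hbes h s
  let S₀ : H →ₗ[ℂ] lp (fun _ : ℕ => ℂ) 2 :=
    { toFun := fun h => ⟨fun j => inner ℂ (f j) h, hmem h⟩
      map_add' := fun x y => by ext j; exact inner_add_right _ _ _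
      map_smul' := fun c x => by ext j; exact inner_smul_right _ _ _ }
  have hS₀ : ∀ h, ‖S₀ h‖ ≤ √B * ‖h‖ := fun h => by
    refine lp.norm_le_of_forall_sum_le (by norm_num) (by positivity) fun s => ?_
    have := hbes h s
    rw [ENNReal.toReal_ofNat, Real.rpow_ofNat, mul_pow, Real.sq_sqrt hB0]
    simpa [S₀] using this
  let S : H →L[ℂ] lp (fun _ : ℕ => ℂ) 2 := S₀.mkContinuous (√B) hS₀
  have hS : ∀ h j, S h j = inner ℂ (f j) h := fun h j => rfl
  -- The adjoint of the analysis operator `S` is the synthesis operator `c ↦ ∑ c_j f_j`; the lower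
  -- Gram bound extends to it by density of finite sums.
  let T := ContinuousLinearMap.adjoint S
  have hT : ∀ j a, T (lp.single 2 j a) = a • f j := fun j a => by
    refine ext_inner_right ℂ fun h => ?_
    rw [ContinuousLinearMap.adjoint_inner_left, lp.inner_single_left, hS, inner_smul_left]
    simp [mul_comm]
  have hbelow : ∀ c, A * ‖c‖ ^ 2 ≤ ‖T c‖ ^ 2 := fun c => by
    have hc := lp.hasSum_single (p := 2) (by norm_num) c
    have h1 : Filter.Tendsto (fun s : Finset ℕ => ∑ j ∈ s, ‖c j‖ ^ 2) Filter.atTop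
        (nhds (‖c‖ ^ 2)) := by
      have := lp.hasSum_norm (p := 2) (by norm_num) c
      simpa [HasSum] using this
    refine le_of_tendsto_of_tendsto (h1.const_mul A)
      (((T.continuous.tendsto c).comp hc).norm.pow 2) (Filter.Eventually.of_forall fun s => ?_)
    simp only [Function.comp_apply, map_sum, hT]
    exact hlow s fun j => c j
  -- Lax–Milgram: `⟨S T c, c⟩ = ‖T c‖² ≥ A ‖c‖²`, so the Gram operator `S T` is invertible and `S`
  -- is onto `ℓ²`.
  have hunit : IsUnit (S ∘L T) := by
    refine ContinuousLinearMap.isUnit_of_forall_le_norm_inner_map _ (c := ⟨A, hA.le⟩) hA fun c => ?_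
    have : inner ℂ ((S ∘L T) c) c = ((‖T c‖ ^ 2 : ℝ) : ℂ) := by
      rw [ContinuousLinearMap.comp_apply, ← ContinuousLinearMap.adjoint_inner_right,
        inner_self_eq_norm_sq_to_K]
      norm_cast
    rw [this, Complex.norm_real, Real.norm_of_nonneg (sq_nonneg _)]
    exact (mul_comm _ _).trans_le (hbelow c)
  refine Set.Subset.antisymm ?_ fun c hc => ?_
  · rintro _ ⟨h, rfl⟩
    exact hmem h
  · obtain ⟨R, hR⟩ := hunit.exists_right_inv
    refine ⟨T (R ⟨c, hc⟩), funext fun j => ?_⟩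
    have := DFunLike.congr_fun hR (⟨c, hc⟩ : lp (fun _ : ℕ => ℂ) 2)
    simpa [hS] using congrArg (fun u : lp (fun _ : ℕ => ℂ) 2 => u j) this

end RieszSequence

end BesselRiesz

namespace BesselRiesz

/-! ### The inverse Fourier transform on `L¹ ∩ L²` -/

section FourierInversion

variable {V : Type*} [NormedAddCommGroup V] [InnerProductSpace ℝ V] [FiniteDimensional ℝ V]
  [MeasurableSpace V] [BorelSpace V]

/-- Fubini for the Fourier integral attached to the bilinear form `-⟨·,·⟩`, which is symmetric and
whose transform is `𝓕⁻`. -/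
lemma integral_fourierInv_smul_eq {f g : V → ℂ} (hf : Integrable f) (hg : Integrable g) :
    ∫ ξ, 𝓕⁻ f ξ • g ξ = ∫ ξ, f ξ • 𝓕⁻ g ξ := by
  have h := VectorFourier.integral_fourierIntegral_smul_eq_flip (μ := volume) (ν := volume)
    (L := -innerₗ V) Real.continuous_fourierChar
    (continuous_inner (𝕜 := ℝ) (E := V)).neg hf hg
  have hflip : (-innerₗ V).flip = -innerₗ V := by
    ext v w
    simp [real_inner_comm]
  rw [hflip] at h
  exact h

lemma continuous_fourierInv {f : V → ℂ} (hf : Integrable f) : Continuous (𝓕⁻ f) :=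
  VectorFourier.fourierIntegral_continuous Real.continuous_fourierChar
    (continuous_inner (𝕜 := ℝ) (E := V)).neg hf

/-- On `L¹ ∩ L²` the inverse `L²` Fourier transform is given by the Fourier integral. -/
theorem fourierInv_toLp_ae_eq {f : V → ℂ} (h1 : Integrable f) (h2 : MemLp f 2) :
    ((𝓕⁻ (h2.toLp f) : Lp (α := V) ℂ 2 volume) : V → ℂ) =ᵐ[volume] 𝓕⁻ f := by
  refine ae_eq_of_integral_contDiff_smul_eq (μ := volume) (MemLp.locallyIntegrable (μ := volume)
    (Lp.memLp (𝓕⁻ (h2.toLp f) : Lp (α := V) ℂ 2 volume)) one_le_two)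
    (Continuous.locallyIntegrable (μ := volume) (continuous_fourierInv h1)) fun g hg hgc => ?_
  have hc : HasCompactSupport (Complex.ofRealCLM ∘ g) := hgc.comp_left rfl
  have hd : ContDiff ℝ (⊤ : ℕ∞) (Complex.ofRealCLM ∘ g) := Complex.ofRealCLM.contDiff.comp hg
  -- A smooth compactly supported test function is Schwartz, so duality can move `𝓕⁻` onto it and
  -- back onto `f`, first in tempered distributions and then by Fubini.
  set G : SchwartzMap V ℂ := hc.toSchwartzMap hd with hG
  have hGg : ∀ x, G x = g x := fun x => by simp [hG]
  calc ∫ x, g x • (𝓕⁻ (h2.toLp f) : Lp (α := V) ℂ 2 volume) x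
      = Lp.toTemperedDistribution (𝓕⁻ (h2.toLp f) : Lp (α := V) ℂ 2 volume) G := by
        simp [Lp.toTemperedDistribution_apply, hGg]
    _ = (Lp.toTemperedDistribution (h2.toLp f)) (𝓕⁻ G) := by
        rw [← Lp.fourierInv_toTemperedDistribution_eq, TemperedDistribution.fourierInv_apply]
    _ = ∫ x, (𝓕⁻ G) x • f x := by
        rw [Lp.toTemperedDistribution_apply]
        refine integral_congr_ae ?_
        filter_upwards [h2.coeFn_toLp] with x hx
        rw [hx]
    _ = ∫ x, G x • 𝓕⁻ f x := by
        rw [← integral_fourierInv_smul_eq G.integrable h1, SchwartzMap.fourierInv_coe]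
    _ = ∫ x, g x • 𝓕⁻ f x := by simp [hGg]

end FourierInversion

/-! ### Completeness of `H^α` -/

section Isometry

variable {n : ℕ} {α : ℝ}

/-- The Sobolev weight in the frequency variable of Mathlib's Fourier transform. -/
noncomputable def dilWeight {n : ℕ} (α : ℝ) (ξ : EuclideanSpace ℝ (Fin n)) : ℝ := weight α ((2 * Real.pi) • ξ)

lemma dilWeight_pos (α : ℝ) (ξ : EuclideanSpace ℝ (Fin n)) : 0 < dilWeight α ξ := weight_pos _ _

lemma continuous_dilWeight (α : ℝ) :
    Continuous (dilWeight α : EuclideanSpace ℝ (Fin n) → ℝ) :=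
  (continuous_weight α).comp (continuous_const_smul _)

lemma dilWeight_mul (α β : ℝ) (ξ : EuclideanSpace ℝ (Fin n)) :
    dilWeight α ξ * dilWeight β ξ = dilWeight (α + β) ξ :=
  (Real.rpow_add (by positivity) α β).symm

lemma dilWeight_zero (ξ : EuclideanSpace ℝ (Fin n)) : dilWeight 0 ξ = 1 := Real.rpow_zero _

lemma dilWeight_le_one (hα : α ≤ 0) (ξ : EuclideanSpace ℝ (Fin n)) : dilWeight α ξ ≤ 1 :=
  Real.rpow_le_one_of_one_le_of_nonpos (by nlinarith [sq_nonneg ‖(2 * Real.pi) • ξ‖]) hα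

lemma fourierHat_smul_two_pi (u : L2 n) (ξ : EuclideanSpace ℝ (Fin n)) :
    fourierHat u ((2 * Real.pi) • ξ) = (𝓕 u : L2 n) ξ := by
  rw [fourierHat, smul_smul, inv_mul_cancel₀ (by positivity), one_smul]

lemma finiteEnergy_iff (u : L2 n) : FiniteEnergy α u ↔
    Integrable (fun ξ => dilWeight α ξ * ‖(𝓕 u : L2 n) ξ‖ ^ 2) volume := by
  rw [FiniteEnergy, ← integrable_comp_smul_iff volume _ (R := 2 * Real.pi) (by positivity)]
  simp only [fourierHat_smul_two_pi, dilWeight]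

/-- The Jacobian of the dilation is exactly the factor `(2π)^{-n}` of the `H^α` product, so the
formulas in the dilated frequency carry no constant. -/
lemma integral_comp_two_pi_smul {F : Type*} [NormedAddCommGroup F] [NormedSpace ℝ F]
    (f : EuclideanSpace ℝ (Fin n) → F) :
    ∫ ξ, f ((2 * Real.pi) • ξ) = ((2 * Real.pi) ^ n)⁻¹ • ∫ ξ, f ξ := by
  rw [Measure.integral_comp_smul, finrank_euclideanSpace_fin, abs_of_pos (by positivity)]

lemma sobolev_inner_eq (v u : SobolevSpace n α) : inner ℂ v u =
    ∫ ξ, (𝓕 u.toL2 : L2 n) ξ * (starRingEnd ℂ) ((𝓕 v.toL2 : L2 n) ξ) * (dilWeight α ξ : ℂ) := by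
  rw [SobolevSpace.inner_eq, SobolevSpace.sobolevInner, ← Complex.real_smul,
    ← integral_comp_two_pi_smul]
  simp only [fourierHat_smul_two_pi, dilWeight]

lemma sobolev_norm_sq (u : SobolevSpace n α) :
    ‖u‖ ^ 2 = ∫ ξ, dilWeight α ξ * ‖(𝓕 u.toL2 : L2 n) ξ‖ ^ 2 := by
  have h := inner_self_eq_norm_sq_to_K (𝕜 := ℂ) u
  rw [SobolevSpace.inner_eq, SobolevSpace.sobolevInner_self, ← smul_eq_mul,
    ← integral_comp_two_pi_smul] at h
  simp only [fourierHat_smul_two_pi] at h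
  apply Complex.ofReal_injective
  rw [Complex.ofReal_pow]
  exact h.symm

lemma norm_sq_eq_integral (u : L2 n) : ‖u‖ ^ 2 = ∫ ξ, ‖u ξ‖ ^ 2 := by
  have h := inner_self_eq_norm_sq_to_K (𝕜 := ℂ) u
  rw [L2.inner_def] at h
  simp only [inner_self_eq_norm_sq_to_K] at h
  have h2 : ∫ a, ((‖u a‖ : ℂ)) ^ 2 = ((∫ a, ‖u a‖ ^ 2 : ℝ) : ℂ) := by
    rw [← integral_complex_ofReal]
    simp
  have h3 := h2.symm.trans h
  apply Complex.ofReal_injective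
  rw [Complex.ofReal_pow]
  exact h3.symm

lemma aestronglyMeasurable_dilWeight_mul {f : EuclideanSpace ℝ (Fin n) → ℂ} {β : ℝ}
    (hf : AEStronglyMeasurable f volume) :
    AEStronglyMeasurable (fun ξ => (dilWeight β ξ : ℂ) * f ξ) volume :=
  (Complex.continuous_ofReal.comp (continuous_dilWeight β)).aestronglyMeasurable.mul hf

lemma memLp_dilWeight_mul (u : SobolevSpace n α) :
    MemLp (fun ξ => (dilWeight (α / 2) ξ : ℂ) * (𝓕 u.toL2 : L2 n) ξ) 2 volume := by
  rw [memLp_two_iff_integrable_sq_norm (aestronglyMeasurable_dilWeight_mul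
    (Lp.aestronglyMeasurable _))]
  refine ((finiteEnergy_iff _).1 u.finiteEnergy).congr (Filter.Eventually.of_forall fun ξ => ?_)
  simp only
  rw [norm_mul, mul_pow, Complex.norm_real, Real.norm_of_nonneg (dilWeight_pos _ _).le,
    sq (dilWeight _ ξ), dilWeight_mul, add_halves]

/-- The isometry `u ↦ (1 + |ξ|²)^{α/2} û` from `H^α` to `L²`. -/
noncomputable def toWeightedL2 (n : ℕ) (α : ℝ) : SobolevSpace n α →ₗᵢ[ℂ] L2 n where
  toFun u := (memLp_dilWeight_mul u).toLp _
  map_add' u v := by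
    rw [← MemLp.toLp_add, MemLp.toLp_eq_toLp_iff]
    have h : (𝓕 (u + v).toL2 : L2 n) = 𝓕 u.toL2 + 𝓕 v.toL2 := FourierTransform.fourier_add _ _
    filter_upwards [Lp.coeFn_add (𝓕 u.toL2 : L2 n) (𝓕 v.toL2)] with ξ hξ
    rw [h, hξ]
    simp [mul_add]
  map_smul' c u := by
    rw [RingHom.id_apply, ← MemLp.toLp_const_smul, MemLp.toLp_eq_toLp_iff]
    have h : (𝓕 (c • u).toL2 : L2 n) = c • 𝓕 u.toL2 := FourierTransform.fourier_smul _ _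
    filter_upwards [Lp.coeFn_smul c (𝓕 u.toL2 : L2 n)] with ξ hξ
    rw [h, hξ]
    simp only [Pi.smul_apply, smul_eq_mul]
    ring
  norm_map' u := by
    refine (sq_eq_sq₀ (norm_nonneg _) (norm_nonneg _)).1 ?_
    simp only [LinearMap.coe_mk, AddHom.coe_mk]
    rw [norm_sq_eq_integral, sobolev_norm_sq]
    refine integral_congr_ae ?_
    filter_upwards [(memLp_dilWeight_mul u).coeFn_toLp] with ξ hξ
    rw [hξ, norm_mul, mul_pow, Complex.norm_real, Real.norm_of_nonneg (dilWeight_pos _ _).le,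
      sq (dilWeight _ ξ), dilWeight_mul, add_halves]

/-- The preimage is found by multiplying with the weight of exponent `-α/2`. For `α ≥ 0` this weight
is at most `1`, so the product stays in `L²` and can be transformed back. -/
lemma toWeightedL2_surjective (hα : 0 ≤ α) : Function.Surjective (toWeightedL2 n α) := by
  intro v
  have hmem : MemLp (fun ξ => (dilWeight (-(α / 2)) ξ : ℂ) * v ξ) 2 volume := by
    refine (Lp.memLp v).of_le (aestronglyMeasurable_dilWeight_mul
      (Lp.aestronglyMeasurable _))
      (Filter.Eventually.of_forall fun ξ => ?_)
    rw [norm_mul, Complex.norm_real, Real.norm_of_nonneg (dilWeight_pos _ _).le]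
    exact mul_le_of_le_one_left (norm_nonneg _) (dilWeight_le_one (by linarith) _)
  have hF : (𝓕 (𝓕⁻ (hmem.toLp _) : L2 n) : L2 n) = hmem.toLp _ :=
    FourierTransform.fourier_fourierInv_eq _
  have hen : FiniteEnergy α (𝓕⁻ (hmem.toLp _) : L2 n) := by
    rw [finiteEnergy_iff, hF]
    refine ((memLp_two_iff_integrable_sq_norm (Lp.aestronglyMeasurable v)).1 (Lp.memLp v)).congr ?_
    filter_upwards [hmem.coeFn_toLp] with ξ hξ
    rw [hξ, norm_mul, mul_pow, Complex.norm_real, Real.norm_of_nonneg (dilWeight_pos _ _).le,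
      sq (dilWeight _ ξ), ← mul_assoc, dilWeight_mul, dilWeight_mul, show α + (-(α / 2) + -(α / 2)) = 0 by ring,
      dilWeight_zero, one_mul]
  let u : SobolevSpace n α := ⟨(𝓕⁻ (hmem.toLp _) : L2 n), hen⟩
  have hu : (𝓕 u.toL2 : L2 n) = hmem.toLp _ := hF
  refine ⟨u, Lp.ext ?_⟩
  filter_upwards [hmem.coeFn_toLp, (memLp_dilWeight_mul u).coeFn_toLp] with ξ h1 h2
  refine h2.trans ?_
  rw [hu, h1, ← mul_assoc, ← Complex.ofReal_mul, dilWeight_mul, add_neg_cancel, dilWeight_zero,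
    Complex.ofReal_one, one_mul]

theorem completeSpace_sobolevSpace (hα : 0 ≤ α) : CompleteSpace (SobolevSpace n α) :=
  (LinearIsometryEquiv.ofSurjective (toWeightedL2 n α)
    (toWeightedL2_surjective hα)).toIsometryEquiv.completeSpace

end Isometry

end BesselRiesz

namespace BesselRiesz

/-! ### `G_α` as an average of heat kernels and its Fourier transform -/

section BesselKernel

open Real Set

variable {n : ℕ} {α : ℝ}

/-- Substituting `t = (z / 2) e^{-s}` in the integral that defines `K_ν`. -/
lemma integral_rpow_mul_exp_eq_besselK (ν : ℝ) {z : ℝ} (hz : 0 < z) :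
    ∫ t in Ioi (0 : ℝ), t ^ (ν - 1) * exp (-t - z ^ 2 / (4 * t)) =
      2 * (z / 2) ^ ν * besselK ν z := by
  have him : (fun s : ℝ => z / 2 * exp (-s)) '' univ = Ioi 0 := by
    ext t
    simp only [image_univ, mem_range, mem_Ioi]
    refine ⟨?_, fun ht => ⟨-log (t / (z / 2)), ?_⟩⟩
    · rintro ⟨s, rfl⟩
      positivity
    · rw [neg_neg, exp_log (by positivity)]
      field_simp
  have hinj : InjOn (fun s : ℝ => z / 2 * exp (-s)) univ := fun a _ b _ hab => by
    have := exp_injective (mul_left_cancel₀ (by positivity : z / 2 ≠ 0) hab)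
    linarith
  have hder : ∀ s ∈ (univ : Set ℝ), HasDerivWithinAt (fun s : ℝ => z / 2 * exp (-s))
      (-(z / 2 * exp (-s))) univ s := fun s _ => by
    have := ((hasDerivAt_neg s).exp.const_mul (z / 2)).hasDerivWithinAt (s := univ)
    simpa using this
  rw [← him, integral_image_eq_integral_abs_deriv_smul MeasurableSet.univ hder hinj,
    setIntegral_univ, besselK, ← mul_assoc, ← integral_const_mul]
  congr 1
  ext s
  have hp : 0 < z / 2 * exp (-s) := by positivity
  -- With `t = (z/2) e^{-s}`, the sum `t + z²/(4t)` is `(z/2)(e^{-s} + e^s)`.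
  have h1 : -(z / 2 * exp (-s)) - z ^ 2 / (4 * (z / 2 * exp (-s))) = -z * cosh s := by
    rw [cosh_eq, exp_neg]
    field_simp
    ring
  rw [abs_neg, abs_of_pos hp, smul_eq_mul, h1, ← mul_assoc, rpow_sub_one hp.ne',
    mul_div_cancel₀ _ hp.ne', mul_rpow (by positivity) (exp_pos _).le, ← exp_mul, sub_eq_add_neg,
    exp_add, show -s * ν = -(ν * s) by ring]
  ring

/-- The subordination integrand, whose integral over `t > 0` is `Γ(α) G_α`. -/
noncomputable def heatIntegrand (n : ℕ) (α z t : ℝ) : ℝ :=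
  t ^ (α - 1) * exp (-t) * ((4 * π * t) ^ (-(n : ℝ) / 2) * exp (-z ^ 2 / (4 * t)))

lemma heatIntegrand_eq {t : ℝ} (ht : 0 < t) (z : ℝ) : heatIntegrand n α z t =
    (4 * π) ^ (-(n : ℝ) / 2) * (t ^ (α - n / 2 - 1) * exp (-t - z ^ 2 / (4 * t))) := by
  rw [heatIntegrand, mul_rpow (by positivity) ht.le,
    show α - n / 2 - 1 = (α - 1) + -(n : ℝ) / 2 by ring, rpow_add ht, sub_eq_add_neg (-t), exp_add, neg_div]
  ring_nf

lemma integrableOn_heatIntegrand (hα : (n : ℝ) / 2 < α) (z : ℝ) :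
    IntegrableOn (heatIntegrand n α z) (Ioi 0) := by
  have hν : 0 < α - n / 2 := by linarith
  refine (((GammaIntegral_convergent hν).const_mul ((4 * π) ^ (-(n : ℝ) / 2)))).mono' ?_ ?_
  · refine ContinuousOn.aestronglyMeasurable (fun t (ht : 0 < t) => ?_) measurableSet_Ioi
    refine ContinuousAt.continuousWithinAt ?_
    unfold heatIntegrand
    have : t ≠ 0 := ht.ne'
    have : 4 * π * t ≠ 0 := by positivity
    fun_prop (disch := first | assumption | positivity | (left; assumption))
  · refine (ae_restrict_iff' measurableSet_Ioi).2 (Filter.Eventually.of_forall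
      fun t (ht : 0 < t) => ?_)
    rw [heatIntegrand_eq ht, norm_of_nonneg (by positivity), mul_comm (exp (-t))]
    gcongr
    have : 0 ≤ z ^ 2 / (4 * t) := by positivity
    linarith

/-- For `z > 0` this is the substitution for `K_{α - n/2}` with powers of `2` matched. At `z = 0`
the integrand is that of `Γ(α - n/2)`, which yields the limit value built into `besselProfile`. -/
theorem integral_heatIntegrand (hα : (n : ℝ) / 2 < α) {z : ℝ} (hz : 0 ≤ z) :
    ∫ t in Ioi (0 : ℝ), heatIntegrand n α z t = Gamma α * besselProfile n α z := by
  have hα0 : 0 < α := lt_of_le_of_lt (by positivity) hα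
  have hΓ := Gamma_pos_of_pos hα0
  have hν : 0 < α - n / 2 := by linarith
  have h4 : (4 * π) ^ ((n : ℝ) / 2) = 2 ^ (n : ℝ) * π ^ ((n : ℝ) / 2) := by
    rw [mul_rpow (by norm_num) pi_pos.le, show (4 : ℝ) = 2 ^ (2 : ℝ) by norm_num,
      ← rpow_mul (by norm_num)]
    congr 2
    ring
  rw [setIntegral_congr_fun measurableSet_Ioi fun t ht => heatIntegrand_eq ht z,
    integral_const_mul, neg_div, rpow_neg (by positivity)]
  rcases hz.eq_or_lt with rfl | hz
  · rw [besselProfile, if_pos rfl, Gamma_eq_integral hν]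
    simp only [ne_eq, OfNat.ofNat_ne_zero, not_false_eq_true, zero_pow, zero_div, sub_zero]
    simp only [mul_comm (exp _)]
    field_simp
  · rw [integral_rpow_mul_exp_eq_besselK _ hz, besselProfile, if_neg hz.ne', h4,
      div_rpow hz.le (by norm_num),
      show (2 : ℝ) ^ (α - 1 + (n : ℝ) / 2) = 2 ^ (n : ℝ) * 2 ^ (α - n / 2) / 2 by
        rw [← rpow_add (by norm_num), ← rpow_sub_one (by norm_num)]
        congr 1
        ring]
    field_simp

/-- The Gamma integral at rate `1 + 4π²|ξ|²`, with the exponential split so that the dependence on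
`ξ` is Gaussian. -/
lemma dilWeight_neg_eq_integral (hα : 0 < α) (ξ : EuclideanSpace ℝ (Fin n)) :
    ∫ t in Ioi (0 : ℝ), t ^ (α - 1) * exp (-t) * exp (-(4 * π ^ 2 * t) * ‖ξ‖ ^ 2) =
      Gamma α * dilWeight (-α) ξ := by
  have h := integral_rpow_mul_exp_neg_mul_Ioi hα
    (show 0 < 1 + ‖(2 * π) • ξ‖ ^ 2 by positivity)
  rw [one_div, inv_rpow (by positivity), ← rpow_neg (by positivity),
    mul_comm _ (Gamma α)] at h
  rw [dilWeight, weight, ← h]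
  refine integral_congr_ae (Filter.Eventually.of_forall fun t => ?_)
  simp only
  rw [mul_assoc, ← exp_add, norm_smul, norm_of_nonneg (by positivity : 0 ≤ 2 * π)]
  congr 2
  ring

lemma integrable_dilWeight_neg (hα : (n : ℝ) / 2 < α) :
    Integrable (dilWeight (-α) : EuclideanSpace ℝ (Fin n) → ℝ) volume := by
  have h : Integrable (fun ξ : EuclideanSpace ℝ (Fin n) => (1 + ‖ξ‖ ^ 2) ^ (-(2 * α) / 2)) volume :=
    integrable_rpow_neg_one_add_norm_sq (by rw [finrank_euclideanSpace_fin]; linarith)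
  rw [← integrable_comp_smul_iff volume _ (R := 2 * π) (by positivity)] at h
  refine h.congr (Filter.Eventually.of_forall fun ξ => ?_)
  simp only [dilWeight, weight]
  congr 1
  ring

/-- The Gaussian integral with linear term `2πi⟨y, ξ⟩`; its value is the heat kernel at time `t`. -/
lemma integral_gaussian_char {t : ℝ} (ht : 0 < t) (y : EuclideanSpace ℝ (Fin n)) :
    ∫ ξ : EuclideanSpace ℝ (Fin n), 𝐞 (inner ℝ ξ y) • (exp (-(4 * π ^ 2 * t) * ‖ξ‖ ^ 2) : ℂ) =
      ((4 * π * t) ^ (-(n : ℝ) / 2) * exp (-‖y‖ ^ 2 / (4 * t)) : ℝ) := by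
  have h := GaussianFourier.integral_cexp_neg_mul_sq_norm_add (V := EuclideanSpace ℝ (Fin n))
    (b := (4 * π ^ 2 * t : ℝ)) (by rw [Complex.ofReal_re]; positivity) (2 * π * Complex.I) y
  have h1 : (π : ℂ) / ((4 * π ^ 2 * t : ℝ) : ℂ) = ((4 * π * t)⁻¹ : ℝ) := by
    rw [← Complex.ofReal_div]
    congr 1
    field_simp
  have h2 : (2 * π * Complex.I) ^ 2 * (‖y‖ : ℂ) ^ 2 / (4 * ((4 * π ^ 2 * t : ℝ) : ℂ)) =
      ((-‖y‖ ^ 2 / (4 * t) : ℝ) : ℂ) := by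
    have : (π : ℂ) ≠ 0 := by exact_mod_cast pi_ne_zero
    have : (t : ℂ) ≠ 0 := by exact_mod_cast ht.ne'
    rw [mul_pow, Complex.I_sq]
    push_cast
    field_simp
    ring
  have h3 : ((Module.finrank ℝ (EuclideanSpace ℝ (Fin n)) : ℂ) / 2) = ((n / 2 : ℝ) : ℂ) := by
    rw [finrank_euclideanSpace_fin]
    push_cast
    rfl
  rw [h1, h2, h3, ← Complex.ofReal_cpow (by positivity), inv_rpow (by positivity),
    ← rpow_neg (by positivity), ← neg_div, ← Complex.ofReal_exp, ← Complex.ofReal_mul] at h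
  rw [← h]
  refine integral_congr_ae (Filter.Eventually.of_forall fun ξ => ?_)
  simp only [Circle.smul_def, fourierChar_apply, smul_eq_mul, Complex.ofReal_exp]
  rw [← Complex.exp_add, real_inner_comm]
  congr 1
  push_cast
  ring

/-- The inverse Fourier transform of `(1 + 4π²|ξ|²)^{-α}` is `G_α`. -/
theorem integral_char_smul_dilWeight (hα : (n : ℝ) / 2 < α) (y : EuclideanSpace ℝ (Fin n)) :
    ∫ ξ : EuclideanSpace ℝ (Fin n), 𝐞 (inner ℝ ξ y) • (dilWeight (-α) ξ : ℂ) =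
      (besselG n α y : ℂ) := by
  have hα0 : 0 < α := lt_of_le_of_lt (by positivity) hα
  have hΓ : (Gamma α : ℂ) ≠ 0 := by exact_mod_cast (Gamma_pos_of_pos hα0).ne'
  let k : EuclideanSpace ℝ (Fin n) → ℝ → ℝ := fun ξ t =>
    t ^ (α - 1) * exp (-t) * exp (-(4 * π ^ 2 * t) * ‖ξ‖ ^ 2)
  have hk0 : ∀ ξ, ∀ t ∈ Ioi (0 : ℝ), 0 ≤ k ξ t := fun ξ t (ht : 0 < t) => by positivity
  have hkm : Measurable (Function.uncurry k) := by
    unfold k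
    fun_prop
  have hchar : Continuous fun ξ : EuclideanSpace ℝ (Fin n) => 𝐞 (inner ℝ ξ y) :=
    continuous_fourierChar.comp (continuous_id.inner continuous_const)
  have hint : Integrable (Function.uncurry fun (ξ : EuclideanSpace ℝ (Fin n)) (t : ℝ) =>
      𝐞 (inner ℝ ξ y) • (k ξ t : ℂ)) (volume.prod (volume.restrict (Ioi 0))) := by
    have hkint : Integrable (Function.uncurry k) (volume.prod (volume.restrict (Ioi 0))) := by
      rw [integrable_prod_iff hkm.aestronglyMeasurable]
      have hv : ∀ ξ, ∫ t in Ioi (0 : ℝ), k ξ t = Gamma α * dilWeight (-α) ξ :=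
        dilWeight_neg_eq_integral hα0
      constructor
      · refine Filter.Eventually.of_forall fun ξ => ?_
        -- A non-integrable function has integral `0` by convention, whereas the value computed in
        -- `hv` is positive.
        by_contra hcon
        have h0 := hv ξ
        rw [integral_undef (f := fun t => k ξ t) hcon] at h0
        exact (mul_pos (Gamma_pos_of_pos hα0) (dilWeight_pos _ _)).ne h0
      · refine ((integrable_dilWeight_neg hα).const_mul (Gamma α)).congr
          (Filter.Eventually.of_forall fun ξ => ?_)
        simp only [Function.uncurry_apply_pair]
        rw [← hv]
        exact setIntegral_congr_fun measurableSet_Ioi fun t ht =>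
          (norm_of_nonneg (hk0 ξ t ht)).symm
    refine hkint.mono ?_ (Filter.Eventually.of_forall fun p => ?_)
    · refine AEStronglyMeasurable.smul
        (continuous_subtype_val.comp (hchar.comp continuous_fst)).aestronglyMeasurable ?_
      exact (Complex.measurable_ofReal.comp hkm).aestronglyMeasurable
    · simp [Function.uncurry, Circle.norm_smul]
  have hswap := integral_integral_swap hint
  have hL : ∀ ξ : EuclideanSpace ℝ (Fin n), ∫ t in Ioi (0 : ℝ), 𝐞 (inner ℝ ξ y) • (k ξ t : ℂ) =
      Gamma α * (𝐞 (inner ℝ ξ y) • (dilWeight (-α) ξ : ℂ)) := fun ξ => by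
    simp only [Circle.smul_def, smul_eq_mul]
    rw [integral_const_mul, integral_complex_ofReal, dilWeight_neg_eq_integral hα0]
    push_cast
    ring
  have hR : ∀ t ∈ Ioi (0 : ℝ), ∫ ξ : EuclideanSpace ℝ (Fin n), 𝐞 (inner ℝ ξ y) • (k ξ t : ℂ) =
      (heatIntegrand n α ‖y‖ t : ℂ) := fun t ht => by
    rw [heatIntegrand, Complex.ofReal_mul, ← integral_gaussian_char ht, ← integral_const_mul]
    refine integral_congr_ae (Filter.Eventually.of_forall fun ξ => ?_)
    simp only [k, Circle.smul_def, smul_eq_mul]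
    push_cast
    ring
  simp only [hL] at hswap
  rw [integral_const_mul, setIntegral_congr_fun measurableSet_Ioi hR, integral_complex_ofReal,
    integral_heatIntegrand hα (norm_nonneg y), Complex.ofReal_mul] at hswap
  exact mul_left_cancel₀ hΓ hswap

end BesselKernel

end BesselRiesz

namespace BesselRiesz

/-! ### The upper Gram bound -/

section UpperBound

open Real Set

variable {n : ℕ} {α : ℝ}

lemma besselG_nonneg (hα : (n : ℝ) / 2 < α) (y : EuclideanSpace ℝ (Fin n)) :
    0 ≤ besselG n α y := by
  have hΓ := Gamma_pos_of_pos (lt_of_le_of_lt (by positivity) hα : 0 < α)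
  have h := integral_heatIntegrand hα (norm_nonneg y)
  have h0 : 0 ≤ ∫ t in Ioi (0 : ℝ), heatIntegrand n α ‖y‖ t :=
    setIntegral_nonneg measurableSet_Ioi fun t (ht : 0 < t) => by
      unfold heatIntegrand
      positivity
  rw [h] at h0
  exact nonneg_of_mul_nonneg_right h0 hΓ

lemma integrable_gaussian {b : ℝ} (hb : 0 < b) :
    Integrable (fun y : EuclideanSpace ℝ (Fin n) => exp (-b * ‖y‖ ^ 2)) volume := by
  have h := (GaussianFourier.integrable_cexp_neg_mul_sq_norm_add
    (V := EuclideanSpace ℝ (Fin n)) (b := b) (by simpa using hb) 0 0).norm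
  refine h.congr (Filter.Eventually.of_forall fun y => ?_)
  simp only [zero_mul, add_zero, Complex.norm_exp]
  congr 1
  norm_cast

/-- A Gaussian sum over a separated set, without the diagonal term, is bounded by an integral. -/
lemma sum_gaussian_le {x : ℕ → EuclideanSpace ℝ (Fin n)} {δ t : ℝ}
    (hx : ∀ j k, j ≠ k → δ ≤ ‖x j - x k‖) (ht : 0 < t) (s : Finset ℕ) (j : ℕ) :
    volume.real (Metric.ball (0 : EuclideanSpace ℝ (Fin n)) (δ / 2)) *
        ∑ k ∈ s.erase j, exp (-‖x j - x k‖ ^ 2 / (4 * t)) ≤ (9 * π * t) ^ ((n : ℝ) / 2) := by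
  have hb : 0 < 1 / (9 * t) := by positivity
  -- On the ball of radius `δ/2` about `x k`, `|y - x_j| ≤ (3/2)|x_j - x_k|` because `δ ≤ |x_j -
  -- x_k|`. The rate `1/(9t)` turns the squared factor `9/4` into `1/(4t)`.
  set F : EuclideanSpace ℝ (Fin n) → ℝ := fun y => exp (-(1 / (9 * t)) * ‖y - x j‖ ^ 2) with hF
  have hFi : Integrable F volume := (integrable_gaussian hb).comp_sub_right (x j)
  have hball : ∀ k ∈ s.erase j,
      volume.real (Metric.ball (0 : EuclideanSpace ℝ (Fin n)) (δ / 2)) *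
        exp (-‖x j - x k‖ ^ 2 / (4 * t)) ≤ ∫ y in Metric.ball (x k) (δ / 2), F y := fun k hk => by
    have hjk := hx j k (Finset.ne_of_mem_erase hk).symm
    have hvol : volume.real (Metric.ball (0 : EuclideanSpace ℝ (Fin n)) (δ / 2)) =
        volume.real (Metric.ball (x k) (δ / 2)) := by
      rw [Measure.real, Measure.real, Measure.addHaar_ball_center volume (x k)]
    rw [hvol, ← smul_eq_mul, ← setIntegral_const]
    refine setIntegral_mono_on (integrableOn_const measure_ball_lt_top.ne) hFi.integrableOn
      measurableSet_ball fun y hy => ?_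
    refine exp_le_exp.2 ?_
    rw [mem_ball_iff_norm] at hy
    have h1 : ‖y - x j‖ ≤ 3 / 2 * ‖x j - x k‖ := by
      have := norm_sub_le_norm_sub_add_norm_sub y (x k) (x j)
      rw [norm_sub_rev (x k)] at this
      linarith
    have h2 : ‖y - x j‖ ^ 2 ≤ 9 / 4 * ‖x j - x k‖ ^ 2 := by
      calc ‖y - x j‖ ^ 2 ≤ (3 / 2 * ‖x j - x k‖) ^ 2 := by gcongr
        _ = _ := by ring
    calc -‖x j - x k‖ ^ 2 / (4 * t) = -(1 / (9 * t)) * (9 / 4 * ‖x j - x k‖ ^ 2) := by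
          field_simp
      _ ≤ -(1 / (9 * t)) * ‖y - x j‖ ^ 2 :=
          mul_le_mul_of_nonpos_left h2 (by linarith)
  have hdisj : (s.erase j : Set ℕ).Pairwise
      (Function.onFun Disjoint fun k => Metric.ball (x k) (δ / 2)) := fun k _ l _ hkl => by
    refine Metric.ball_disjoint_ball ?_
    rw [dist_eq_norm, add_halves]
    exact hx k l hkl
  rw [Finset.mul_sum]
  calc _ ≤ ∑ k ∈ s.erase j, ∫ y in Metric.ball (x k) (δ / 2), F y := Finset.sum_le_sum hball
    _ = ∫ y in ⋃ k ∈ s.erase j, Metric.ball (x k) (δ / 2), F y :=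
        (integral_biUnion_finset _ (fun _ _ => measurableSet_ball) hdisj
          fun _ _ => hFi.integrableOn).symm
    _ ≤ ∫ y, F y := setIntegral_le_integral hFi (Filter.Eventually.of_forall fun y => (exp_pos _).le)
    _ = ∫ y : EuclideanSpace ℝ (Fin n), exp (-(1 / (9 * t)) * ‖y‖ ^ 2) :=
        integral_sub_right_eq_self (fun y => exp (-(1 / (9 * t)) * ‖y‖ ^ 2)) (x j)
    _ = (9 * π * t) ^ ((n : ℝ) / 2) := by
        rw [GaussianFourier.integral_rexp_neg_mul_sq_norm hb, finrank_euclideanSpace_fin]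
        congr 1
        field_simp

/-- The rows of the Gram matrix of a separated sequence are uniformly summable. -/
theorem exists_sum_besselG_le (hα : (n : ℝ) / 2 < α) {x : ℕ → EuclideanSpace ℝ (Fin n)} {δ : ℝ}
    (hδ : 0 < δ) (hx : ∀ j k, j ≠ k → δ ≤ ‖x j - x k‖) :
    ∃ B : ℝ, ∀ (s : Finset ℕ) (j : ℕ), ∑ k ∈ s, besselG n α (x j - x k) ≤ B := by
  have hα0 : 0 < α := lt_of_le_of_lt (by positivity) hα
  have hΓ := Gamma_pos_of_pos hα0
  set V := volume.real (Metric.ball (0 : EuclideanSpace ℝ (Fin n)) (δ / 2)) with hV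
  have hVpos : 0 < V := ENNReal.toReal_pos (Metric.measure_ball_pos _ _ (by positivity)).ne'
    measure_ball_lt_top.ne
  -- The heat kernel factor `(4πt)^{-n/2}` cancels the `t` in the packing bound `(9πt)^{n/2} / V`,
  -- leaving a constant. The diagonal term admits no such uniform bound in `t` when `n > 0` and is
  -- counted separately as `G_α(0)`.
  set K := (9 / 4 : ℝ) ^ ((n : ℝ) / 2) / V with hK
  refine ⟨besselG n α 0 + K, fun s j => ?_⟩
  have hoff : ∑ k ∈ s.erase j, besselG n α (x j - x k) ≤ K := by
    refine le_of_mul_le_mul_left ?_ hΓ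
    calc Gamma α * ∑ k ∈ s.erase j, besselG n α (x j - x k)
        = ∑ k ∈ s.erase j, ∫ t in Ioi (0 : ℝ), heatIntegrand n α ‖x j - x k‖ t := by
          rw [Finset.mul_sum]
          exact Finset.sum_congr rfl fun k _ => (integral_heatIntegrand hα (norm_nonneg _)).symm
      _ = ∫ t in Ioi (0 : ℝ), ∑ k ∈ s.erase j, heatIntegrand n α ‖x j - x k‖ t :=
          (integral_finsetSum _ fun k _ => integrableOn_heatIntegrand hα _).symm
      _ ≤ ∫ t in Ioi (0 : ℝ), K * (exp (-t) * t ^ (α - 1)) := by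
          refine setIntegral_mono_on
            (integrable_finsetSum _ fun k _ => integrableOn_heatIntegrand hα _)
            ((GammaIntegral_convergent hα0).const_mul K) measurableSet_Ioi fun t (ht : 0 < t) => ?_
          have h1 := sum_gaussian_le hx ht s j
          have h2 : ∑ k ∈ s.erase j, exp (-‖x j - x k‖ ^ 2 / (4 * t)) ≤
              (9 * π * t) ^ ((n : ℝ) / 2) / V := by
            rw [le_div_iff₀ hVpos, mul_comm]
            exact h1
          have h3 : (4 * π * t) ^ (-(n : ℝ) / 2) * ((9 * π * t) ^ ((n : ℝ) / 2) / V) = K := by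
            have hu : 0 < 4 * π * t := by positivity
            rw [hK, show 9 * π * t = 9 / 4 * (4 * π * t) by ring,
              mul_rpow (by norm_num) hu.le, neg_div, rpow_neg hu.le, ← mul_div_assoc,
              mul_left_comm, inv_mul_cancel₀ (rpow_pos_of_pos hu _).ne', mul_one]
          calc ∑ k ∈ s.erase j, heatIntegrand n α ‖x j - x k‖ t
              = t ^ (α - 1) * exp (-t) * ((4 * π * t) ^ (-(n : ℝ) / 2) *
                  ∑ k ∈ s.erase j, exp (-‖x j - x k‖ ^ 2 / (4 * t))) := by
                simp only [heatIntegrand, Finset.mul_sum]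
            _ ≤ t ^ (α - 1) * exp (-t) * ((4 * π * t) ^ (-(n : ℝ) / 2) *
                  ((9 * π * t) ^ ((n : ℝ) / 2) / V)) := by gcongr
            _ = _ := by rw [h3]; ring
      _ = Gamma α * K := by
          rw [integral_const_mul, ← Gamma_eq_integral hα0, mul_comm]
  have hK0 : 0 ≤ K := by positivity
  by_cases hj : j ∈ s
  · rw [← Finset.add_sum_erase s _ hj, sub_self]
    linarith
  · rw [Finset.erase_eq_of_notMem hj] at hoff
    have := besselG_nonneg hα (0 : EuclideanSpace ℝ (Fin n))
    linarith

/-- Schur's test for finite sections of a Gram matrix. -/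
lemma norm_sum_smul_sq_le {H : Type*} [NormedAddCommGroup H] [InnerProductSpace ℂ H] {f : ℕ → H}
    {B : ℝ} (hB : ∀ (s : Finset ℕ) (j : ℕ), ∑ k ∈ s, ‖inner ℂ (f j) (f k)‖ ≤ B)
    (s : Finset ℕ) (c : ℕ → ℂ) : ‖∑ j ∈ s, c j • f j‖ ^ 2 ≤ B * ∑ j ∈ s, ‖c j‖ ^ 2 := by
  have h1 : ‖∑ j ∈ s, c j • f j‖ ^ 2 ≤
      ∑ j ∈ s, ∑ k ∈ s, ‖c j‖ * ‖c k‖ * ‖inner ℂ (f j) (f k)‖ := by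
    have h := norm_sum_le s fun j => inner ℂ (c j • f j) (∑ k ∈ s, c k • f k)
    rw [← sum_inner, inner_self_eq_norm_sq_to_K, norm_pow, RCLike.norm_ofReal, abs_norm] at h
    refine h.trans (Finset.sum_le_sum fun j _ => ?_)
    rw [inner_sum]
    refine (norm_sum_le _ _).trans (Finset.sum_le_sum fun k _ => ?_)
    rw [inner_smul_left, inner_smul_right, norm_mul, norm_mul, RCLike.norm_conj, mul_assoc]
  have h2 : ∀ j k, ‖c j‖ * ‖c k‖ * ‖inner ℂ (f j) (f k)‖ ≤
      ‖c j‖ ^ 2 / 2 * ‖inner ℂ (f j) (f k)‖ + ‖c k‖ ^ 2 / 2 * ‖inner ℂ (f k) (f j)‖ := fun j k => by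
    rw [norm_inner_symm (f k), ← add_mul]
    gcongr
    nlinarith [sq_nonneg (‖c j‖ - ‖c k‖)]
  have h3 : ∑ j ∈ s, ∑ k ∈ s, ‖c j‖ ^ 2 / 2 * ‖inner ℂ (f j) (f k)‖ ≤
      B * (∑ j ∈ s, ‖c j‖ ^ 2) / 2 := by
    rw [Finset.mul_sum, Finset.sum_div]
    refine Finset.sum_le_sum fun j _ => ?_
    rw [← Finset.mul_sum]
    have := mul_le_mul_of_nonneg_left (hB s j) (by positivity : 0 ≤ ‖c j‖ ^ 2 / 2)
    linarith
  have h4 : ∑ j ∈ s, ∑ k ∈ s, ‖c k‖ ^ 2 / 2 * ‖inner ℂ (f k) (f j)‖ ≤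
      B * (∑ j ∈ s, ‖c j‖ ^ 2) / 2 := by
    rw [Finset.sum_comm]
    exact h3
  have h5 := Finset.sum_le_sum fun j (_ : j ∈ s) =>
    Finset.sum_le_sum fun k (_ : k ∈ s) => h2 j k
  simp only [Finset.sum_add_distrib] at h5
  linarith

end UpperBound

end BesselRiesz

namespace BesselRiesz

/-! ### Translates of `G_α` and their Gram matrix -/

section Translates

variable {n : ℕ} {α : ℝ}

/-- The Fourier transform of the translate `G_α(· - x)`. -/
noncomputable def besselSymbol {n : ℕ} (α : ℝ) (x ξ : EuclideanSpace ℝ (Fin n)) : ℂ :=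
  (Real.fourierChar (-inner ℝ ξ x) : ℂ) * (dilWeight (-α) ξ : ℂ)

lemma norm_besselSymbol (x ξ : EuclideanSpace ℝ (Fin n)) :
    ‖besselSymbol α x ξ‖ = dilWeight (-α) ξ := by
  rw [besselSymbol, norm_mul, Circle.norm_coe, one_mul, Complex.norm_real,
    Real.norm_of_nonneg (dilWeight_pos _ _).le]

lemma continuous_besselSymbol (x : EuclideanSpace ℝ (Fin n)) :
    Continuous (besselSymbol α x) :=
  (continuous_subtype_val.comp (Real.continuous_fourierChar.comp
    (continuous_id.inner continuous_const).neg)).mul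
    (Complex.continuous_ofReal.comp (continuous_dilWeight _))

lemma integrable_besselSymbol (hα : (n : ℝ) / 2 < α) (x : EuclideanSpace ℝ (Fin n)) :
    Integrable (besselSymbol α x) volume :=
  (integrable_dilWeight_neg hα).mono' (continuous_besselSymbol x).aestronglyMeasurable
    (Filter.Eventually.of_forall fun ξ => (norm_besselSymbol x ξ).le)

lemma memLp_besselSymbol (hα : (n : ℝ) / 2 < α) (x : EuclideanSpace ℝ (Fin n)) :
    MemLp (besselSymbol α x) 2 volume := by
  have hα0 : 0 < α := lt_of_le_of_lt (by positivity) hα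
  rw [memLp_two_iff_integrable_sq_norm (continuous_besselSymbol x).aestronglyMeasurable]
  refine (integrable_dilWeight_neg (hα.trans (by linarith : α < α + α))).congr
    (Filter.Eventually.of_forall fun ξ => ?_)
  simp only [norm_besselSymbol]
  rw [sq, dilWeight_mul, neg_add]

lemma fourier_fourierInv_besselSymbol (hα : (n : ℝ) / 2 < α) (x : EuclideanSpace ℝ (Fin n)) :
    (𝓕 (𝓕⁻ ((memLp_besselSymbol hα x).toLp _) : L2 n) : L2 n) =ᵐ[volume] besselSymbol α x := by
  rw [FourierTransform.fourier_fourierInv_eq]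
  exact MemLp.coeFn_toLp _

lemma finiteEnergy_besselSymbol (hα : (n : ℝ) / 2 < α) (x : EuclideanSpace ℝ (Fin n)) :
    FiniteEnergy α (𝓕⁻ ((memLp_besselSymbol hα x).toLp _) : L2 n) := by
  rw [finiteEnergy_iff]
  refine (integrable_dilWeight_neg hα).congr ?_
  filter_upwards [fourier_fourierInv_besselSymbol hα x] with ξ hξ
  rw [hξ, norm_besselSymbol, sq, ← mul_assoc, dilWeight_mul, add_neg_cancel, dilWeight_zero,
    one_mul]

/-- The translate `G_α(· - x)` as an element of `H^α`. -/
noncomputable def besselTranslate (hα : (n : ℝ) / 2 < α) (x : EuclideanSpace ℝ (Fin n)) :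
    SobolevSpace n α :=
  ⟨(𝓕⁻ ((memLp_besselSymbol hα x).toLp _) : L2 n), finiteEnergy_besselSymbol hα x⟩

lemma fourier_besselTranslate (hα : (n : ℝ) / 2 < α) (x : EuclideanSpace ℝ (Fin n)) :
    (𝓕 (besselTranslate hα x).toL2 : L2 n) =ᵐ[volume] besselSymbol α x :=
  fourier_fourierInv_besselSymbol hα x

/-- The translate is defined on the Fourier side. Its symbol lies in `L¹ ∩ L²`, so the `L²` inverse
transform is the pointwise integral already identified with `G_α`. -/
theorem besselTranslate_ae_eq (hα : (n : ℝ) / 2 < α) (x : EuclideanSpace ℝ (Fin n)) :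
    ((besselTranslate hα x).toL2 : EuclideanSpace ℝ (Fin n) → ℂ) =ᵐ[volume]
      fun y => (besselG n α (y - x) : ℂ) := by
  refine (fourierInv_toLp_ae_eq (integrable_besselSymbol hα x)
    (memLp_besselSymbol hα x)).trans (Filter.Eventually.of_forall fun y => ?_)
  simp only
  rw [Real.fourierInv_eq, ← integral_char_smul_dilWeight hα]
  refine integral_congr_ae (Filter.Eventually.of_forall fun ξ => ?_)
  simp only [besselSymbol, Circle.smul_def, smul_eq_mul]
  rw [← mul_assoc, ← Circle.coe_mul, ← AddChar.map_add_eq_mul, inner_sub_right, sub_eq_add_neg]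

/-- The Gram matrix of the translates is given by the kernel itself. -/
theorem inner_besselTranslate (hα : (n : ℝ) / 2 < α) (x y : EuclideanSpace ℝ (Fin n)) :
    inner ℂ (besselTranslate hα x) (besselTranslate hα y) = (besselG n α (x - y) : ℂ) := by
  rw [sobolev_inner_eq, ← integral_char_smul_dilWeight hα]
  refine integral_congr_ae ?_
  filter_upwards [fourier_besselTranslate hα x, fourier_besselTranslate hα y] with ξ hx hy
  have hw : (dilWeight (-α) ξ : ℂ) * (dilWeight α ξ : ℂ) = 1 := by
    rw [← Complex.ofReal_mul, dilWeight_mul, neg_add_cancel, dilWeight_zero, Complex.ofReal_one]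
  rw [hx, hy]
  simp only [besselSymbol, Circle.smul_def, smul_eq_mul, map_mul, Complex.conj_ofReal]
  rw [← Circle.coe_inv_eq_conj, ← AddChar.map_neg_eq_inv, neg_neg, inner_sub_right, sub_eq_add_neg,
    AddChar.map_add_eq_mul, Circle.coe_mul]
  linear_combination ((Real.fourierChar (-inner ℝ ξ y) : ℂ) * (Real.fourierChar (inner ℝ ξ x) : ℂ) *
    (dilWeight (-α) ξ : ℂ)) * hw

/-- The trigonometric sum with frequencies `x j` and coefficients `c j`. -/
noncomputable def trigSum {n : ℕ} (x : ℕ → EuclideanSpace ℝ (Fin n)) (s : Finset ℕ) (c : ℕ → ℂ)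
    (ξ : EuclideanSpace ℝ (Fin n)) : ℂ :=
  ∑ j ∈ s, c j * (Real.fourierChar (-inner ℝ ξ (x j)) : ℂ)

lemma fourier_sum_besselTranslate (hα : (n : ℝ) / 2 < α) (x : ℕ → EuclideanSpace ℝ (Fin n))
    (s : Finset ℕ) (c : ℕ → ℂ) :
    (𝓕 (∑ j ∈ s, c j • besselTranslate hα (x j)).toL2 : L2 n) =ᵐ[volume]
      fun ξ => trigSum x s c ξ * (dilWeight (-α) ξ : ℂ) := by
  classical
  induction s using Finset.induction_on with
  | empty =>
    have h : (𝓕 (0 : SobolevSpace n α).toL2 : L2 n) = 0 := FourierTransform.fourier_zero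
    rw [Finset.sum_empty, h]
    filter_upwards [Lp.coeFn_zero ℂ 2 (volume : Measure (EuclideanSpace ℝ (Fin n)))] with ξ hξ
    rw [hξ, trigSum, Finset.sum_empty, zero_mul, Pi.zero_apply]
  | insert j s hj ih =>
    rw [Finset.sum_insert hj, SobolevSpace.toL2_add, SobolevSpace.toL2_smul,
      FourierTransform.fourier_add, FourierTransform.fourier_smul]
    filter_upwards [ih, Lp.coeFn_add (c j • (𝓕 (besselTranslate hα (x j)).toL2 : L2 n))
      (𝓕 (∑ j ∈ s, c j • besselTranslate hα (x j)).toL2 : L2 n),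
      Lp.coeFn_smul (c j) (𝓕 (besselTranslate hα (x j)).toL2 : L2 n),
      fourier_besselTranslate hα (x j)] with ξ h1 h2 h3 h4
    rw [h2, Pi.add_apply, h1, h3, Pi.smul_apply, h4, smul_eq_mul, besselSymbol]
    simp only [trigSum, Finset.sum_insert hj]
    ring

lemma weighted_fourier_sum_besselTranslate (hα : (n : ℝ) / 2 < α)
    (x : ℕ → EuclideanSpace ℝ (Fin n)) (s : Finset ℕ) (c : ℕ → ℂ) :
    (fun ξ => dilWeight α ξ *
      ‖(𝓕 (∑ j ∈ s, c j • besselTranslate hα (x j)).toL2 : L2 n) ξ‖ ^ 2) =ᵐ[volume]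
      fun ξ => ‖trigSum x s c ξ‖ ^ 2 * dilWeight (-α) ξ := by
  filter_upwards [fourier_sum_besselTranslate hα x s c] with ξ hξ
  have hw : dilWeight α ξ * dilWeight (-α) ξ = 1 := by
    rw [dilWeight_mul, add_neg_cancel, dilWeight_zero]
  rw [hξ, norm_mul, Complex.norm_real, Real.norm_of_nonneg (dilWeight_pos _ _).le]
  linear_combination (‖trigSum x s c ξ‖ ^ 2 * dilWeight (-α) ξ) * hw

lemma integrable_trigSum (hα : (n : ℝ) / 2 < α) (x : ℕ → EuclideanSpace ℝ (Fin n))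
    (s : Finset ℕ) (c : ℕ → ℂ) :
    Integrable (fun ξ => ‖trigSum x s c ξ‖ ^ 2 * dilWeight (-α) ξ) volume :=
  ((finiteEnergy_iff _).1 (SobolevSpace.finiteEnergy _)).congr
    (weighted_fourier_sum_besselTranslate hα x s c)

lemma norm_sq_sum_besselTranslate (hα : (n : ℝ) / 2 < α) (x : ℕ → EuclideanSpace ℝ (Fin n))
    (s : Finset ℕ) (c : ℕ → ℂ) :
    ‖∑ j ∈ s, c j • besselTranslate hα (x j)‖ ^ 2 =
      ∫ ξ, ‖trigSum x s c ξ‖ ^ 2 * dilWeight (-α) ξ := by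
  rw [sobolev_norm_sq]
  exact integral_congr_ae (weighted_fourier_sum_besselTranslate hα x s c)

end Translates

/-! ### The lower Gram bound -/

section LowerBound

variable {n : ℕ} {α : ℝ}

/-- Translation becomes the same modulation as in `besselSymbol`, so a sum of translates of `Φ` has
transform `trigSum` times `𝓕 Φ`. -/
lemma fourier_compSubConst (Φ : SchwartzMap (EuclideanSpace ℝ (Fin n)) ℂ)
    (a ξ : EuclideanSpace ℝ (Fin n)) :
    𝓕 (Φ.compSubConstCLM ℂ a) ξ = (Real.fourierChar (-inner ℝ ξ a) : ℂ) * 𝓕 Φ ξ := by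
  rw [SchwartzMap.fourier_coe, SchwartzMap.fourier_coe, Real.fourier_eq, Real.fourier_eq,
    ← integral_const_mul]
  rw [← integral_sub_right_eq_self (fun v => (Real.fourierChar (-inner ℝ ξ a) : ℂ) *
    (Real.fourierChar (-inner ℝ v ξ) • Φ v)) a]
  refine integral_congr_ae (Filter.Eventually.of_forall fun v => ?_)
  simp only [SchwartzMap.compSubConstCLM_apply, Circle.smul_def, smul_eq_mul]
  rw [← mul_assoc, ← Circle.coe_mul, ← AddChar.map_add_eq_mul, inner_sub_left, real_inner_comm a ξ]
  congr 4
  ring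

/-- At most one term is nonzero, so there are no cross terms. -/
lemma norm_sq_sum_of_pairwise_mul_eq_zero (s : Finset ℕ) (a : ℕ → ℂ)
    (ha : ∀ j k, j ≠ k → a j ≠ 0 → a k = 0) : ‖∑ j ∈ s, a j‖ ^ 2 = ∑ j ∈ s, ‖a j‖ ^ 2 := by
  by_cases h : ∃ j ∈ s, a j ≠ 0
  · obtain ⟨j, hj, hja⟩ := h
    rw [Finset.sum_eq_single_of_mem j hj fun k _ hk => ha j k hk.symm hja,
      Finset.sum_eq_single_of_mem j hj fun k _ hk => by simp [ha j k hk.symm hja]]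
  · push Not at h
    rw [Finset.sum_eq_zero h, Finset.sum_eq_zero fun j hj => by simp [h j hj]]
    simp

/-- Plancherel's theorem for a sum of translates with disjoint supports. -/
lemma integral_trigSum_mul_fourier {x : ℕ → EuclideanSpace ℝ (Fin n)} {δ : ℝ}
    (hx : ∀ j k, j ≠ k → δ ≤ ‖x j - x k‖) (Φ : SchwartzMap (EuclideanSpace ℝ (Fin n)) ℂ)
    (hΦ : ∀ y, δ / 2 ≤ ‖y‖ → Φ y = 0) (s : Finset ℕ) (c : ℕ → ℂ) :
    ∫ ξ, ‖trigSum x s c ξ‖ ^ 2 * ‖𝓕 Φ ξ‖ ^ 2 = (∫ y, ‖Φ y‖ ^ 2) * ∑ j ∈ s, ‖c j‖ ^ 2 := by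
  set F : SchwartzMap (EuclideanSpace ℝ (Fin n)) ℂ :=
    ∑ j ∈ s, c j • Φ.compSubConstCLM ℂ (x j) with hF
  have hFy : ∀ y, F y = ∑ j ∈ s, c j * Φ (y - x j) := fun y => by
    simp [hF]
  have hFF : ∀ ξ, 𝓕 F ξ = trigSum x s c ξ * 𝓕 Φ ξ := fun ξ => by
    have h : 𝓕 F = ∑ j ∈ s, c j • 𝓕 (Φ.compSubConstCLM ℂ (x j)) := by
      rw [hF, ← FourierTransform.fourierCLM_apply (R := ℂ), map_sum]
      simp
    rw [h, sum_apply, trigSum, Finset.sum_mul]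
    refine Finset.sum_congr rfl fun j _ => ?_
    rw [smul_apply, fourier_compSubConst, smul_eq_mul, mul_assoc]
  have hdis : ∀ y j k, j ≠ k → c j * Φ (y - x j) ≠ 0 → c k * Φ (y - x k) = 0 := by
    intro y j k hjk h
    have h1 : ‖y - x j‖ < δ / 2 := by
      by_contra hcon
      exact h (by rw [hΦ _ (not_lt.1 hcon), mul_zero])
    have h2 : δ ≤ ‖y - x k‖ + ‖y - x j‖ := by
      refine (hx j k hjk).trans ?_
      rw [show x j - x k = (y - x k) - (y - x j) by abel]
      exact norm_sub_le _ _
    rw [hΦ _ (by linarith), mul_zero]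
  have hint : Integrable (fun y => ‖Φ y‖ ^ 2) volume :=
    (memLp_two_iff_integrable_sq_norm Φ.continuous.aestronglyMeasurable).1 (Φ.memLp 2)
  calc ∫ ξ, ‖trigSum x s c ξ‖ ^ 2 * ‖𝓕 Φ ξ‖ ^ 2 = ∫ ξ, ‖𝓕 F ξ‖ ^ 2 := by
        simp only [hFF, norm_mul, mul_pow]
    _ = ∫ y, ‖F y‖ ^ 2 := SchwartzMap.integral_norm_sq_fourier F
    _ = ∫ y, ∑ j ∈ s, ‖c j‖ ^ 2 * ‖Φ (y - x j)‖ ^ 2 := by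
        refine integral_congr_ae (Filter.Eventually.of_forall fun y => ?_)
        simp only [hFy]
        rw [norm_sq_sum_of_pairwise_mul_eq_zero s _ (hdis y)]
        simp only [norm_mul, mul_pow]
    _ = ∑ j ∈ s, ‖c j‖ ^ 2 * ∫ y, ‖Φ y‖ ^ 2 := by
        rw [integral_finsetSum _ fun j _ => (hint.comp_sub_right (x j)).const_mul _]
        refine Finset.sum_congr rfl fun j _ => ?_
        rw [integral_const_mul, integral_sub_right_eq_self (fun y => ‖Φ y‖ ^ 2) (x j)]
    _ = _ := by rw [← Finset.sum_mul, mul_comm]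

/-- Schwartz decay beats the polynomial growth of the inverse weight. -/
lemma exists_norm_sq_schwartz_le (Ψ : SchwartzMap (EuclideanSpace ℝ (Fin n)) ℂ) (α : ℝ) :
    ∃ C, 0 < C ∧ ∀ ξ, ‖Ψ ξ‖ ^ 2 ≤ C * dilWeight (-α) ξ := by
  obtain ⟨k, hk⟩ := exists_nat_ge α
  obtain ⟨C, hC⟩ : ∃ C, ∀ ξ, (1 + ‖ξ‖) ^ k * ‖Ψ ξ‖ ≤ C := ⟨_, fun ξ => by
    simpa using SchwartzMap.one_add_le_sup_seminorm_apply (𝕜 := ℝ) (m := (k, 0)) le_rfl le_rfl Ψ ξ⟩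
  have hC0 : 0 ≤ C := (by positivity : 0 ≤ (1 + ‖(0 : EuclideanSpace ℝ (Fin n))‖) ^ k * ‖Ψ 0‖).trans
    (hC 0)
  -- The summand `1` only makes the constant strictly positive, since `C` may vanish.
  refine ⟨((2 * Real.pi) ^ 2) ^ k * C ^ 2 + 1, by positivity, fun ξ => ?_⟩
  have hb : 1 + ‖(2 * Real.pi) • ξ‖ ^ 2 ≤ (2 * Real.pi) ^ 2 * (1 + ‖ξ‖) ^ 2 := by
    rw [norm_smul, Real.norm_of_nonneg (by positivity)]
    nlinarith [Real.pi_gt_three, norm_nonneg ξ, mul_nonneg (sq_nonneg Real.pi) (norm_nonneg ξ)]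
  have hw : dilWeight α ξ ≤ ((2 * Real.pi) ^ 2) ^ k * ((1 + ‖ξ‖) ^ k) ^ 2 := by
    calc dilWeight α ξ ≤ dilWeight (k : ℝ) ξ :=
          Real.rpow_le_rpow_of_exponent_le (by nlinarith [sq_nonneg ‖(2 * Real.pi) • ξ‖]) hk
      _ = (1 + ‖(2 * Real.pi) • ξ‖ ^ 2) ^ k := Real.rpow_natCast _ _
      _ ≤ ((2 * Real.pi) ^ 2 * (1 + ‖ξ‖) ^ 2) ^ k := by gcongr
      _ = _ := by rw [mul_pow, pow_right_comm (1 + ‖ξ‖)]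
  have h1 : dilWeight α ξ * ‖Ψ ξ‖ ^ 2 ≤ ((2 * Real.pi) ^ 2) ^ k * C ^ 2 + 1 := by
    calc dilWeight α ξ * ‖Ψ ξ‖ ^ 2
        ≤ ((2 * Real.pi) ^ 2) ^ k * ((1 + ‖ξ‖) ^ k) ^ 2 * ‖Ψ ξ‖ ^ 2 := by gcongr
      _ = ((2 * Real.pi) ^ 2) ^ k * ((1 + ‖ξ‖) ^ k * ‖Ψ ξ‖) ^ 2 := by ring
      _ ≤ ((2 * Real.pi) ^ 2) ^ k * C ^ 2 := by
          gcongr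
          exact hC ξ
      _ ≤ _ := by linarith
  have hone : dilWeight (-α) ξ * dilWeight α ξ = 1 := by
    rw [dilWeight_mul, neg_add_cancel, dilWeight_zero]
  calc ‖Ψ ξ‖ ^ 2 = dilWeight (-α) ξ * (dilWeight α ξ * ‖Ψ ξ‖ ^ 2) := by
        rw [← mul_assoc, hone, one_mul]
    _ ≤ dilWeight (-α) ξ * (((2 * Real.pi) ^ 2) ^ k * C ^ 2 + 1) :=
        mul_le_mul_of_nonneg_left h1 (dilWeight_pos _ _).le
    _ = _ := mul_comm _ _

/-- A nonzero Schwartz function supported in a given ball around the origin. -/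
lemma exists_schwartz_supported {δ : ℝ} (hδ : 0 < δ) :
    ∃ Φ : SchwartzMap (EuclideanSpace ℝ (Fin n)) ℂ,
      (∀ y, δ / 2 ≤ ‖y‖ → Φ y = 0) ∧ 0 < ∫ y, ‖Φ y‖ ^ 2 := by
  let b : ContDiffBump (0 : EuclideanSpace ℝ (Fin n)) :=
    ⟨δ / 4, δ / 2, by positivity, by linarith⟩
  have hc : HasCompactSupport (Complex.ofRealCLM ∘ b) := b.hasCompactSupport.comp_left rfl
  have hd : ContDiff ℝ (⊤ : ℕ∞) (Complex.ofRealCLM ∘ b) :=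
    Complex.ofRealCLM.contDiff.comp b.contDiff
  set Φ : SchwartzMap (EuclideanSpace ℝ (Fin n)) ℂ := hc.toSchwartzMap hd with hΦ
  have hval : ∀ y, Φ y = (b y : ℂ) := fun y => by simp [hΦ]
  refine ⟨Φ, fun y hy => ?_, ?_⟩
  · rw [hval, b.zero_of_le_dist (by simpa using hy), Complex.ofReal_zero]
  · have hint : Integrable (fun y => ‖Φ y‖ ^ 2) volume :=
      (memLp_two_iff_integrable_sq_norm Φ.continuous.aestronglyMeasurable).1 (Φ.memLp 2)
    refine integral_pos_of_integrable_nonneg_nonzero (x := 0) (Φ.continuous.norm.pow 2) hint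
      (fun y => sq_nonneg _) ?_
    have h1 : b 0 = 1 := b.one_of_mem_closedBall (Metric.mem_closedBall_self b.rIn_pos.le)
    simp [hval, h1]

/-- Replacing the weight by the smaller `|𝓕 Φ|² / C` makes the norm computable by Plancherel and
gives `A = ‖Φ‖² / C`. -/
theorem exists_lower_gram_bound (hα : (n : ℝ) / 2 < α) {x : ℕ → EuclideanSpace ℝ (Fin n)} {δ : ℝ}
    (hδ : 0 < δ) (hx : ∀ j k, j ≠ k → δ ≤ ‖x j - x k‖) :
    ∃ A : ℝ, 0 < A ∧ ∀ (s : Finset ℕ) (c : ℕ → ℂ),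
      A * ∑ j ∈ s, ‖c j‖ ^ 2 ≤ ‖∑ j ∈ s, c j • besselTranslate hα (x j)‖ ^ 2 := by
  obtain ⟨Φ, hΦ, hpos⟩ := exists_schwartz_supported (n := n) hδ
  obtain ⟨C, hC, hle⟩ := exists_norm_sq_schwartz_le (𝓕 Φ) α
  refine ⟨(∫ y, ‖Φ y‖ ^ 2) / C, div_pos hpos hC, fun s c => ?_⟩
  rw [norm_sq_sum_besselTranslate, div_mul_eq_mul_div, div_le_iff₀ hC,
    ← integral_trigSum_mul_fourier hx Φ hΦ, ← integral_mul_const]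
  refine integral_mono_of_nonneg (Filter.Eventually.of_forall fun ξ => by positivity)
    ((integrable_trigSum hα x s c).mul_const C) (Filter.Eventually.of_forall fun ξ => ?_)
  simp only
  rw [mul_assoc, mul_comm _ C]
  exact mul_le_mul_of_nonneg_left (hle ξ) (sq_nonneg _)

end LowerBound

/-! ### Conclusion -/

/-- Translates of `G_α` along any separated sequence form a Riesz sequence in `H^α`. -/
theorem isRieszSequence_besselTranslate {n : ℕ} {α : ℝ} (hα : (n : ℝ) / 2 < α)
    {x : ℕ → EuclideanSpace ℝ (Fin n)} {δ : ℝ} (hδ : 0 < δ)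
    (hx : ∀ j k, j ≠ k → δ ≤ ‖x j - x k‖) :
    IsRieszSequence fun j => besselTranslate hα (x j) := by
  have := completeSpace_sobolevSpace (n := n) ((by positivity : (0 : ℝ) ≤ n / 2).trans hα.le)
  obtain ⟨A, hA, hlow⟩ := exists_lower_gram_bound hα hδ hx
  obtain ⟨B, hB⟩ := exists_sum_besselG_le hα hδ hx
  refine isRieszSequence_of_gram_bounds hA hlow (norm_sum_smul_sq_le (B := B) fun s j => ?_)
  refine (Finset.sum_congr rfl fun k _ => ?_).trans_le (hB s j)
  rw [inner_besselTranslate, Complex.norm_real, Real.norm_of_nonneg (besselG_nonneg hα _)]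

lemma separation_le {n : ℕ} (x : ℕ → EuclideanSpace ℝ (Fin n)) {j k : ℕ} (hjk : j ≠ k) :
    separation x ≤ ‖x j - x k‖ :=
  ciInf_le (f := fun p : {p : ℕ × ℕ // p.1 ≠ p.2} => ‖x p.1.1 - x p.1.2‖)
    ⟨0, by rintro _ ⟨p, rfl⟩; exact norm_nonneg _⟩ ⟨(j, k), hjk⟩

end BesselRiesz

theorem mainTheorem6 (n : ℕ) (α : ℝ) (hα : (n : ℝ) / 2 < α)
    (x : ℕ → EuclideanSpace ℝ (Fin n)) (hx : 0 < BesselRiesz.separation x) :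
    ∃ g : ℕ → BesselRiesz.SobolevSpace n α,
      (∀ j, ((g j).toL2 : EuclideanSpace ℝ (Fin n) → ℂ) =ᵐ[volume]
        fun y => (BesselRiesz.besselG n α (y - x j) : ℂ)) ∧
      (2 ≤ n → BesselRiesz.IsRieszSequence g) ∧
      (n = 1 →
        4 * Real.Gamma α * Real.Gamma (1 / 2) / Real.Gamma (α - 1 / 2)
          < BesselRiesz.separation x →
        BesselRiesz.IsRieszSequence g) := by
  have hR := BesselRiesz.isRieszSequence_besselTranslate hα hx
    fun j k hjk => BesselRiesz.separation_le x hjk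
  exact ⟨fun j => BesselRiesz.besselTranslate hα (x j),
    fun j => BesselRiesz.besselTranslate_ae_eq hα (x j), fun _ => hR, fun _ _ => hR⟩
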